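/- For $u=(x_u,y_u)\in\mathbb Z^2$ and $r\ge 0$ let $B_r(u)=\{(x,y)\in\mathbb Z^2 : (x-x_u)^2+(y-y_u)^2\le r^2\}$, and for $\Delta\ge 0$ let $$S_{r,\Delta}(u,v)=\bigl(B_r(u)\setminus B_{r+\Delta}(v)\bigr)\cup\bigl(B_r(v)\setminus B_{r+\Delta}(u)\bigr).$$ A set $C\subseteq\mathbb Z^2$ is an $(r,\Delta)$-identifying code if $B_r(u)\cap C\ne\emptyset$ for every $u\in\mathbb Z^2$ and $S_{r,\Delta}(u,v)\cap C\neq\emptyset$ for all distinct $u,v\in\mathbb Z^2$. Its density is $D(C)=\limsup_{n\to\infty}|C\cap Q_n|/|Q_n|$, where $Q_n=\{(x,y)\in\mathbb Z^2: |x|\le n,\ |y|\le n\}$. Let $D(r,\Delta)$ be the infimum of $D(C)$ over all $(r,\Delta)$-identifying codes $C$ (for parameters that admit such codes). Then $(\sqrt5,\sqrt8-\sqrt5)$-identifying codes exist, and $$D(\sqrt5,\sqrt8-\sqrt5)\ge 0.17 .$$ -/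

import Mathlib

open Filter

namespace TolerantCode

/-- The Euclidean distance between two vertices of `ℤ²`. -/
noncomputable def edist2 (u v : ℤ × ℤ) : ℝ :=
  Real.sqrt (((u.1 : ℝ) - (v.1 : ℝ)) ^ 2 + ((u.2 : ℝ) - (v.2 : ℝ)) ^ 2)

/-- The closed Euclidean ball `B_r(u)` in `ℤ²`. -/
def ball (r : ℝ) (u : ℤ × ℤ) : Set (ℤ × ℤ) :=
  {v | edist2 u v ≤ r}

/-- The set `S_{r,Δ}(u,v)` of vertices that are guaranteed to separate `u` from `v`. -/
def sep (r Δ : ℝ) (u v : ℤ × ℤ) : Set (ℤ × ℤ) :=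
  (ball r u \ ball (r + Δ) v) ∪ (ball r v \ ball (r + Δ) u)

/-- `C` is an `(r,Δ)`-tolerant identifying code. -/
def IsIdentifyingCode (r Δ : ℝ) (C : Set (ℤ × ℤ)) : Prop :=
  (∀ u : ℤ × ℤ, (ball r u ∩ C).Nonempty) ∧
    ∀ u v : ℤ × ℤ, u ≠ v → (sep r Δ u v ∩ C).Nonempty

/-- The square `Q_n = {(x,y) : |x| ≤ n, |y| ≤ n}`. -/
def square (n : ℕ) : Set (ℤ × ℤ) :=
  {p | |p.1| ≤ (n : ℤ) ∧ |p.2| ≤ (n : ℤ)}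

/-- The (upper) density `limsup |C ∩ Q_n| / |Q_n|` of a subset of `ℤ²`. The quotients lie in
`[0,1]`, so the real `limsup` is the genuine one. -/
noncomputable def density (C : Set (ℤ × ℤ)) : ℝ :=
  limsup (fun n : ℕ => ((C ∩ square n).ncard : ℝ) / ((square n).ncard : ℝ)) atTop

/-- `D(r,Δ)`: the infimum of the densities of `(r,Δ)`-tolerant identifying codes. For parameters
that admit no such code, the value is the default `0`, so that a positive lower bound for it also
says that codes exist. -/
noncomputable def minDensity (r Δ : ℝ) : ℝ :=
  sInf {x : ℝ | ∃ C : Set (ℤ × ℤ), IsIdentifyingCode r Δ C ∧ density C = x}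

end TolerantCode

namespace TolerantCode

/-! The only points separating two horizontal neighbours are those of two vertical triples five
columns apart, so each such pair of triples meets `C`. A codeword lies in six of these separating
sets, which gives density at least 1/6. The gain comes from the vertical neighbours: if every
horizontal separating set at the positions of a 6 × 6 block had exactly one codeword, the conditions
for vertical neighbours could not all hold (`exists_ne_one_of_hitting`). Each block of 36 positions
thus counts at least 37, and the density is at least 37/216 > 0.17. -/

theorem mem_ball_sqrt_iff {k : ℕ} {u p : ℤ × ℤ} :
    p ∈ ball (Real.sqrt k) u ↔ (u.1 - p.1) ^ 2 + (u.2 - p.2) ^ 2 ≤ (k : ℤ) := by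
  have h : (((u.1 - p.1) ^ 2 + (u.2 - p.2) ^ 2 : ℤ) : ℝ)
      = ((u.1 : ℝ) - p.1) ^ 2 + ((u.2 : ℝ) - p.2) ^ 2 := by push_cast; ring
  rw [ball, Set.mem_ofPred_eq, edist2, Real.sqrt_le_sqrt_iff (Nat.cast_nonneg k), ← h]
  exact_mod_cast Iff.rfl

theorem mem_ball_sqrt_five {u p : ℤ × ℤ} :
    p ∈ ball (Real.sqrt 5) u ↔ (u.1 - p.1) ^ 2 + (u.2 - p.2) ^ 2 ≤ 5 := by
  exact_mod_cast mem_ball_sqrt_iff (k := 5)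

theorem mem_ball_sqrt_eight {u p : ℤ × ℤ} :
    p ∈ ball (Real.sqrt 5 + (Real.sqrt 8 - Real.sqrt 5)) u ↔
      (u.1 - p.1) ^ 2 + (u.2 - p.2) ^ 2 ≤ 8 := by
  rw [add_sub_cancel]
  exact_mod_cast mem_ball_sqrt_iff (k := 8)

theorem mem_sep_iff {u v p : ℤ × ℤ} :
    p ∈ sep (Real.sqrt 5) (Real.sqrt 8 - Real.sqrt 5) u v ↔
      ((u.1 - p.1) ^ 2 + (u.2 - p.2) ^ 2 ≤ 5 ∧ 8 < (v.1 - p.1) ^ 2 + (v.2 - p.2) ^ 2) ∨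
      ((v.1 - p.1) ^ 2 + (v.2 - p.2) ^ 2 ≤ 5 ∧ 8 < (u.1 - p.1) ^ 2 + (u.2 - p.2) ^ 2) := by
  simp only [sep, Set.mem_union, Set.mem_sdiff, mem_ball_sqrt_five, mem_ball_sqrt_eight, not_le]

theorem isIdentifyingCode_univ :
    IsIdentifyingCode (Real.sqrt 5) (Real.sqrt 8 - Real.sqrt 5) Set.univ := by
  refine ⟨fun u => ⟨u, mem_ball_sqrt_five.2 (by simp), trivial⟩, fun u v huv => ?_⟩
  have hne : u.1 ≠ v.1 ∨ u.2 ≠ v.2 := by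
    by_contra! h
    exact huv (Prod.ext h.1 h.2)
  have key : ∃ p, p ∈ sep (Real.sqrt 5) (Real.sqrt 8 - Real.sqrt 5) u v := by
    simp only [mem_sep_iff]
    rcases hne with h | h <;> rcases lt_or_gt_of_ne h with h | h
    -- The witness is two steps from `u` on the side away from `v`, so its squared distance to `v`
    -- is at least 9.
    · exact ⟨(u.1 - 2, u.2), Or.inl ⟨by norm_num, by dsimp only; nlinarith [sq_nonneg (v.2 - u.2)]⟩⟩
    · exact ⟨(u.1 + 2, u.2), Or.inl ⟨by norm_num, by dsimp only; nlinarith [sq_nonneg (v.2 - u.2)]⟩⟩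
    · exact ⟨(u.1, u.2 - 2), Or.inl ⟨by norm_num, by dsimp only; nlinarith [sq_nonneg (v.1 - u.1)]⟩⟩
    · exact ⟨(u.1, u.2 + 2), Or.inl ⟨by norm_num, by dsimp only; nlinarith [sq_nonneg (v.1 - u.1)]⟩⟩
  obtain ⟨p, hp⟩ := key
  exact ⟨p, hp, trivial⟩

/-! ### Separating sets of neighbouring vertices -/

/-- A vector of length at most `√5` that a unit step lengthens beyond `√8`. -/
theorem eq_of_sq_add_sq_le_five {a b : ℤ} (h₁ : a ^ 2 + b ^ 2 ≤ 5)
    (h₂ : 8 < (a + 1) ^ 2 + b ^ 2) : a = 2 ∧ -1 ≤ b ∧ b ≤ 1 := by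
  have ha : a ≤ 2 := by nlinarith
  have ha' : -2 ≤ a := by nlinarith
  have hb : b ≤ 2 := by nlinarith
  have hb' : -2 ≤ b := by nlinarith
  interval_cases a <;> interval_cases b <;> simp_all

/-- The number of codewords in the vertical triple centred at `(x, y)`. -/
noncomputable def colTriple (c : ℤ → ℤ → ℤ) (x y : ℤ) : ℤ := c x (y - 1) + c x y + c x (y + 1)

/-- The number of codewords in the horizontal triple centred at `(x, y)`. -/
noncomputable def rowTriple (c : ℤ → ℤ → ℤ) (x y : ℤ) : ℤ := c (x - 1) y + c x y + c (x + 1) y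

open Classical in
/-- The indicator function of a set of vertices. -/
noncomputable def ind (C : Set (ℤ × ℤ)) (x y : ℤ) : ℤ := if (x, y) ∈ C then 1 else 0

theorem ind_nonneg (C : Set (ℤ × ℤ)) (x y : ℤ) : 0 ≤ ind C x y := by
  unfold ind; split_ifs <;> simp

theorem ind_of_mem {C : Set (ℤ × ℤ)} {x y : ℤ} (h : (x, y) ∈ C) : ind C x y = 1 := if_pos h

theorem one_le_colTriple {C : Set (ℤ × ℤ)} {x y b : ℤ} (hb : -1 ≤ b) (hb' : b ≤ 1)
    (h : (x, y - b) ∈ C) : 1 ≤ colTriple (ind C) x y := by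
  have h₁ := ind_nonneg C x (y - 1)
  have h₂ := ind_nonneg C x y
  have h₃ := ind_nonneg C x (y + 1)
  have h := ind_of_mem h
  unfold colTriple
  obtain rfl | rfl | rfl : b = -1 ∨ b = 0 ∨ b = 1 := by omega
  · rw [sub_neg_eq_add] at h; omega
  · rw [sub_zero] at h; omega
  · omega

theorem one_le_rowTriple {C : Set (ℤ × ℤ)} {x y b : ℤ} (hb : -1 ≤ b) (hb' : b ≤ 1)
    (h : (x - b, y) ∈ C) : 1 ≤ rowTriple (ind C) x y := by
  have h₁ := ind_nonneg C (x - 1) y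
  have h₂ := ind_nonneg C x y
  have h₃ := ind_nonneg C (x + 1) y
  have h := ind_of_mem h
  unfold rowTriple
  obtain rfl | rfl | rfl : b = -1 ∨ b = 0 ∨ b = 1 := by omega
  · rw [sub_neg_eq_add] at h; omega
  · rw [sub_zero] at h; omega
  · omega

theorem colTriple_ind_nonneg (C : Set (ℤ × ℤ)) (x y : ℤ) : 0 ≤ colTriple (ind C) x y :=
  add_nonneg (add_nonneg (ind_nonneg ..) (ind_nonneg ..)) (ind_nonneg ..)

theorem rowTriple_ind_nonneg (C : Set (ℤ × ℤ)) (x y : ℤ) : 0 ≤ rowTriple (ind C) x y :=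
  add_nonneg (add_nonneg (ind_nonneg ..) (ind_nonneg ..)) (ind_nonneg ..)

theorem IsIdentifyingCode.one_le_colTriple_add {C : Set (ℤ × ℤ)}
    (hC : IsIdentifyingCode (Real.sqrt 5) (Real.sqrt 8 - Real.sqrt 5) C) (x y : ℤ) :
    1 ≤ colTriple (ind C) x y + colTriple (ind C) (x + 5) y := by
  obtain ⟨⟨p, q⟩, hp, hpC⟩ := hC.2 (x + 2, y) (x + 3, y) (by simp)
  have h₁ := colTriple_ind_nonneg C x y
  have h₂ := colTriple_ind_nonneg C (x + 5) y
  rcases mem_sep_iff.1 hp with ⟨h, h'⟩ | ⟨h, h'⟩ <;> dsimp only at h h'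
  · obtain ⟨ha, hb, hb'⟩ := eq_of_sq_add_sq_le_five (a := x + 2 - p) (b := y - q) h
      (by convert h' using 3; ring)
    have := one_le_colTriple (x := x) (y := y) hb hb' (by convert hpC using 2 <;> omega)
    omega
  · obtain ⟨ha, hb, hb'⟩ := eq_of_sq_add_sq_le_five (a := p - (x + 3)) (b := y - q)
      (by convert h using 2; ring) (by convert h' using 2; ring)
    have := one_le_colTriple (x := x + 5) (y := y) hb hb' (by convert hpC using 2 <;> omega)
    omega

theorem IsIdentifyingCode.one_le_rowTriple_add {C : Set (ℤ × ℤ)}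
    (hC : IsIdentifyingCode (Real.sqrt 5) (Real.sqrt 8 - Real.sqrt 5) C) (x y : ℤ) :
    1 ≤ rowTriple (ind C) x y + rowTriple (ind C) x (y + 5) := by
  obtain ⟨⟨p, q⟩, hp, hpC⟩ := hC.2 (x, y + 2) (x, y + 3) (by simp)
  have h₁ := rowTriple_ind_nonneg C x y
  have h₂ := rowTriple_ind_nonneg C x (y + 5)
  rcases mem_sep_iff.1 hp with ⟨h, h'⟩ | ⟨h, h'⟩ <;> dsimp only at h h'
  · obtain ⟨ha, hb, hb'⟩ := eq_of_sq_add_sq_le_five (a := y + 2 - q) (b := x - p)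
      (by linarith) (by convert h' using 1; ring)
    have := one_le_rowTriple (x := x) (y := y) hb hb' (by convert hpC using 2 <;> omega)
    omega
  · obtain ⟨ha, hb, hb'⟩ := eq_of_sq_add_sq_le_five (a := q - (y + 3)) (b := x - p)
      (by convert h using 1; ring) (by convert h' using 1; ring)
    have := one_le_rowTriple (x := x) (y := y + 5) hb hb' (by convert hpC using 2 <;> omega)
    omega

/-! ### The contradiction in a 6 × 6 block -/

/-- If all vertical separating pairs are hit, then in each `6 × 6` block of positions some horizontal
separating set does not contain exactly one codeword. -/
theorem exists_ne_one_of_hitting {c : ℤ → ℤ → ℤ} (h₀ : ∀ x y, 0 ≤ c x y)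
    (hrow : ∀ x y, 1 ≤ rowTriple c x y + rowTriple c x (y + 5)) (a b : ℤ) :
    ∃ i ∈ Finset.range 6, ∃ j ∈ Finset.range 6,
      colTriple c (a + i) (b + j) + colTriple c (a + i + 5) (b + j) ≠ 1 := by
  by_contra! H
  -- The shift by `b - 1` makes the triple centred at height `b + j` occupy rows `j`, `j + 1`, `j +
  -- 2`.
  obtain ⟨d, hd⟩ : ∃ d : ℕ → ℕ → ℤ, ∀ i j, d i j = c (a + i) (b - 1 + j) := ⟨_, fun _ _ => rfl⟩
  have d₀ : ∀ i j, 0 ≤ d i j := fun i j => hd i j ▸ h₀ _ _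
  have hcol : ∀ i < 6, ∀ j < 6,
      d i j + d i (j + 1) + d i (j + 2) + (d (i + 5) j + d (i + 5) (j + 1) + d (i + 5) (j + 2)) = 1 := by
    intro i hi j hj
    rw [← H i (Finset.mem_range.2 hi) j (Finset.mem_range.2 hj)]
    simp only [hd, colTriple]
    push_cast
    ring_nf
  have hr : ∀ i j, 1 ≤ (d i j + d (i + 1) j + d (i + 2) j)
      + (d i (j + 5) + d (i + 1) (j + 5) + d (i + 2) (j + 5)) := by
    intro i j
    refine (hrow (a + i + 1) (b - 1 + j)).trans_eq ?_
    simp only [hd, rowTriple]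
    push_cast
    ring_nf
  clear hd H hrow h₀
  set f : ℕ → ℕ → ℤ := fun i j => d i j + d (i + 5) j with hf
  set g : ℕ → ℕ → ℤ := fun i j => d i j + d i (j + 5) with hg
  have f₀ : ∀ i j, 0 ≤ f i j := fun i j => add_nonneg (d₀ ..) (d₀ ..)
  have fsum : ∀ i < 6, f i 0 + f i 1 + f i 2 = 1 := by
    intro i hi
    have := hcol i hi 0 (by omega)
    simp only [hf]; norm_num only at this; omega
  -- Each sum is `f i j + f i (j + 5)`, and `f` has period 3 in `j`.
  have hgf : ∀ i < 6, g i 0 + g (i + 5) 0 = 1 - f i 1 ∧ g i 1 + g (i + 5) 1 = 1 - f i 2 ∧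
      g i 2 + g (i + 5) 2 = 1 - f i 0 := by
    intro i hi
    have e₀ := hcol i hi 0 (by omega)
    have e₁ := hcol i hi 1 (by omega)
    have e₂ := hcol i hi 2 (by omega)
    have e₃ := hcol i hi 3 (by omega)
    have e₄ := hcol i hi 4 (by omega)
    have e₅ := hcol i hi 5 (by omega)
    simp only [hf, hg]
    norm_num only at e₀ e₁ e₂ e₃ e₄ e₅ ⊢
    omega
  have hgr : ∀ i j, 1 ≤ g i j + g (i + 1) j + g (i + 2) j := by
    intro i j
    have := hr i j
    simp only [hg]; omega
  -- Over three consecutive columns and `j = 0, 1, 2`, `hgf` and `fsum` give a total of 9 - 3 = 6.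
  -- It consists of six row sums, each at least 1, so all are equalities.
  have tight : ∀ i < 4, ∀ j < 3, g i j + g (i + 1) j + g (i + 2) j = 1 ∧
      g (i + 5) j + g (i + 6) j + g (i + 7) j = 1 ∧ f i j + f (i + 1) j + f (i + 2) j = 1 := by
    intro i hi
    have s₀ := fsum i (by omega)
    have s₁ := fsum (i + 1) (by omega)
    have s₂ := fsum (i + 2) (by omega)
    have t₀ := hgf i (by omega)
    have t₁ := hgf (i + 1) (by omega)
    have t₂ := hgf (i + 2) (by omega)
    have q₀ := hgr i 0
    have q₁ := hgr i 1
    have q₂ := hgr i 2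
    have r₀ := hgr (i + 5) 0
    have r₁ := hgr (i + 5) 1
    have r₂ := hgr (i + 5) 2
    simp only [add_assoc, Nat.reduceAdd] at t₀ t₁ t₂ r₀ r₁ r₂ s₀ s₁ s₂ q₀ q₁ q₂ ⊢
    intro j hj
    interval_cases j <;> omega
  have fper : ∀ i < 6, ∀ j < 5, f i (j + 3) = f i j := by
    intro i hi j hj
    have e₀ := hcol i hi j (by omega)
    have e₁ := hcol i hi (j + 1) (by omega)
    simp only [add_assoc, Nat.reduceAdd] at e₀ e₁
    simp only [hf]; omega
  -- By `tight`, `f` also has period 3 in `i`, so `f 0 j + f 5 j = 1 - f 4 j`.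
  have fadd : ∀ j < 8, f 0 j + f 5 j ≤ 1 := by
    have base : ∀ j < 3, f 0 j + f 5 j ≤ 1 := by
      intro j hj
      have u₀ := (tight 0 (by omega) j hj).2.2
      have u₁ := (tight 1 (by omega) j hj).2.2
      have u₂ := (tight 2 (by omega) j hj).2.2
      have u₃ := (tight 3 (by omega) j hj).2.2
      have := f₀ 1 j
      have := f₀ 4 j
      norm_num only at u₀ u₁ u₂ u₃
      omega
    intro j
    induction j using Nat.strong_induction_on with
    | _ j ih =>
      intro hj
      rcases lt_or_ge j 3 with h | h
      · exact base j h
      · obtain ⟨k, rfl⟩ := Nat.exists_eq_add_of_le' h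
        rw [fper 0 (by omega) k (by omega), fper 5 (by omega) k (by omega)]
        exact ih k (by omega) (by omega)
  -- Column 5 is counted twice in `fadd`, so integrality makes it empty.
  have d₅ : ∀ j < 8, d 5 j = 0 := by
    intro j hj
    have e : (d 0 j + d 5 j) + (d 5 j + d 10 j) ≤ 1 := fadd j hj
    have := d₀ 0 j
    have := d₀ 5 j
    have := d₀ 10 j
    omega
  -- Here `g 1 j = g 4 j` by `tight` and `g 5 j = 0`.
  have hle : ∀ j < 3, 1 ≤ g 1 j + g 6 j := by
    intro j hj
    have e : g 5 j = d 5 j + d 5 (j + 5) := rfl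
    have := d₅ j (by omega)
    have := d₅ (j + 5) (by omega)
    have w₁ := (tight 1 (by omega) j hj).1
    have w₂ := (tight 2 (by omega) j hj).1
    have w₃ := hgr 4 j
    norm_num only at w₁ w₂ w₃
    omega
  -- Over the three rows, `g 1 j + g 6 j` sums to 3 - 1 = 2 by `hgf`, but to at least 3 by `hle`.
  have s₁ := fsum 1 (by omega)
  have t₁ := hgf 1 (by omega)
  have l₀ := hle 0 (by omega)
  have l₁ := hle 1 (by omega)
  have l₂ := hle 2 (by omega)
  norm_num only at t₁
  omega

/-! ### Counting over blocks and passing to the density -/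

theorem square_eq_coe (n : ℕ) :
    square n = ↑(Finset.Icc (-n : ℤ) n ×ˢ Finset.Icc (-n : ℤ) n) := by
  ext p
  simp only [square, abs_le, Set.mem_ofPred_eq, Finset.mem_coe, Finset.mem_product, Finset.mem_Icc]

theorem square_finite (n : ℕ) : (square n).Finite := square_eq_coe n ▸ Finset.finite_toSet _

theorem ncard_square (n : ℕ) : (square n).ncard = (2 * n + 1) ^ 2 := by
  rw [square_eq_coe, Set.ncard_coe_finset, Finset.card_product, Int.card_Icc, sq]
  congr 1 <;> omega

/-- The positions `((i, j), (a, b))` of an `m × m` array of `6 × 6` blocks. -/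
def blockIndex (m : ℕ) : Finset ((ℕ × ℕ) × (ℕ × ℕ)) :=
  (Finset.range m ×ˢ Finset.range m) ×ˢ (Finset.range 6 ×ˢ Finset.range 6)

theorem sum_blockIndex_ind_le (C : Set (ℤ × ℤ)) {m n : ℕ} {x y : ℤ} (hx : -n ≤ x)
    (hx' : x + 6 * m ≤ n + 1) (hy : -n ≤ y) (hy' : y + 6 * m ≤ n + 1) :
    ∑ p ∈ blockIndex m, ind C (x + 6 * p.1.1 + p.2.1) (y + 6 * p.1.2 + p.2.2)
      ≤ ((C ∩ square n).ncard : ℤ) := by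
  classical
  simp only [ind, Finset.sum_ite, Finset.sum_const_zero, add_zero, Finset.sum_const, nsmul_eq_mul,
    mul_one]
  rw [← Set.ncard_coe_finset, Nat.cast_le]
  refine Set.ncard_le_ncard_of_injOn
    (fun p => (x + 6 * p.1.1 + p.2.1, y + 6 * p.1.2 + p.2.2)) ?_ ?_
    ((square_finite n).subset Set.inter_subset_right)
  · rintro ⟨⟨i, j⟩, a, b⟩ hp
    simp only [blockIndex, Finset.coe_filter, Finset.mem_product, Finset.mem_range,
      Set.mem_ofPred_eq] at hp
    refine ⟨hp.2, ?_⟩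
    simp only [square, Set.mem_ofPred_eq, abs_le]
    omega
  · rintro ⟨⟨i, j⟩, a, b⟩ hp ⟨⟨i', j'⟩, a', b'⟩ hp' h
    simp only [blockIndex, Finset.coe_filter, Finset.mem_product, Finset.mem_range,
      Set.mem_ofPred_eq] at hp hp'
    simp only [Prod.mk.injEq] at h ⊢
    omega

theorem sum_blockIndex_colTriple_le (C : Set (ℤ × ℤ)) {m n : ℕ} {x y : ℤ} (hx : -n ≤ x)
    (hx' : x + 6 * m ≤ n + 1) (hy : -n ≤ y - 1) (hy' : y + 6 * m ≤ n) :
    ∑ p ∈ blockIndex m, colTriple (ind C) (x + 6 * p.1.1 + p.2.1) (y + 6 * p.1.2 + p.2.2)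
      ≤ 3 * ((C ∩ square n).ncard : ℤ) := by
  have h₁ := sum_blockIndex_ind_le C (m := m) hx hx' (y := y - 1) hy (by omega)
  have h₂ := sum_blockIndex_ind_le C (m := m) hx hx' (y := y) (by omega) (by omega)
  have h₃ := sum_blockIndex_ind_le C (m := m) hx hx' (y := y + 1) (by omega) (by omega)
  have e : ∑ p ∈ blockIndex m, colTriple (ind C) (x + 6 * p.1.1 + p.2.1) (y + 6 * p.1.2 + p.2.2) =
      ∑ p ∈ blockIndex m, ind C (x + 6 * p.1.1 + p.2.1) (y - 1 + 6 * p.1.2 + p.2.2) +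
      ∑ p ∈ blockIndex m, ind C (x + 6 * p.1.1 + p.2.1) (y + 6 * p.1.2 + p.2.2) +
      ∑ p ∈ blockIndex m, ind C (x + 6 * p.1.1 + p.2.1) (y + 1 + 6 * p.1.2 + p.2.2) := by
    rw [← Finset.sum_add_distrib, ← Finset.sum_add_distrib]
    refine Finset.sum_congr rfl fun p _ => ?_
    rw [colTriple, add_right_comm y 1, add_right_comm _ 1, sub_add_eq_add_sub,
      sub_add_eq_add_sub]
  linarith

theorem IsIdentifyingCode.block_sum_ge {C : Set (ℤ × ℤ)}
    (hC : IsIdentifyingCode (Real.sqrt 5) (Real.sqrt 8 - Real.sqrt 5) C) (x y : ℤ) :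
    37 ≤ ∑ q ∈ Finset.range 6 ×ˢ Finset.range 6,
      (colTriple (ind C) (x + q.1) (y + q.2) + colTriple (ind C) (x + q.1 + 5) (y + q.2)) := by
  obtain ⟨i, hi, j, hj, hij⟩ := exists_ne_one_of_hitting (ind_nonneg C) hC.one_le_rowTriple_add x y
  have hlt : ∑ q ∈ Finset.range 6 ×ˢ Finset.range 6, (1 : ℤ) <
      ∑ q ∈ Finset.range 6 ×ˢ Finset.range 6,
        (colTriple (ind C) (x + q.1) (y + q.2) + colTriple (ind C) (x + q.1 + 5) (y + q.2)) :=
    Finset.sum_lt_sum (fun q _ => hC.one_le_colTriple_add _ _)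
      ⟨(i, j), Finset.mk_mem_product hi hj, lt_of_le_of_ne (hC.one_le_colTriple_add _ _) hij.symm⟩
  exact Int.add_one_le_iff.2 (by simpa using hlt)

/-- The factor 6 is three positions in a triple times two triples in a separating set. The 5 in
`hmn` leaves room for the second triple. -/
theorem IsIdentifyingCode.le_six_mul_ncard {C : Set (ℤ × ℤ)}
    (hC : IsIdentifyingCode (Real.sqrt 5) (Real.sqrt 8 - Real.sqrt 5) C) {m n : ℕ}
    (hmn : 6 * m + 5 ≤ 2 * n + 1) : 37 * (m : ℤ) ^ 2 ≤ 6 * ((C ∩ square n).ncard : ℤ) := by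
  have h₁ := sum_blockIndex_colTriple_le C (m := m) (n := n) (x := -n) (y := -n + 1)
    (by omega) (by omega) (by omega) (by omega)
  have h₂ := sum_blockIndex_colTriple_le C (m := m) (n := n) (x := -n + 5) (y := -n + 1)
    (by omega) (by omega) (by omega) (by omega)
  have h₃ : ∑ r ∈ Finset.range m ×ˢ Finset.range m, (37 : ℤ) ≤
      ∑ r ∈ Finset.range m ×ˢ Finset.range m, ∑ q ∈ Finset.range 6 ×ˢ Finset.range 6,
        (colTriple (ind C) (-n + 6 * r.1 + q.1) (-n + 1 + 6 * r.2 + q.2) +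
          colTriple (ind C) (-n + 6 * r.1 + q.1 + 5) (-n + 1 + 6 * r.2 + q.2)) :=
    Finset.sum_le_sum fun r _ => hC.block_sum_ge _ _
  rw [← Finset.sum_product', Finset.sum_add_distrib] at h₃
  simp only [Finset.sum_const, Finset.card_product, Finset.card_range, nsmul_eq_mul,
    Nat.cast_mul] at h₃
  have e : ∑ p ∈ blockIndex m,
      colTriple (ind C) (-n + 6 * p.1.1 + p.2.1 + 5) (-n + 1 + 6 * p.1.2 + p.2.2) =
      ∑ p ∈ blockIndex m,
      colTriple (ind C) (-n + 5 + 6 * p.1.1 + p.2.1) (-n + 1 + 6 * p.1.2 + p.2.2) :=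
    Finset.sum_congr rfl fun p _ => by congr 1; ring
  unfold blockIndex at *
  linarith

theorem IsIdentifyingCode.le_density {C : Set (ℤ × ℤ)}
    (hC : IsIdentifyingCode (Real.sqrt 5) (Real.sqrt 8 - Real.sqrt 5) C) :
    0.17 ≤ density C := by
  refine le_limsup_of_frequently_le (Eventually.frequently ?_) ?_
  -- Since 37/216 exceeds 0.17, any sufficiently large threshold absorbs the boundary loss.
  · filter_upwards [eventually_ge_atTop 10000] with n hn
    have h := hC.le_six_mul_ncard (m := (2 * n - 4) / 6) (n := n) (by omega)
    have hm : 2 * (n : ℤ) - 9 ≤ 6 * ((2 * n - 4) / 6 : ℕ) := by omega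
    generalize (2 * n - 4) / 6 = m at h hm
    have h' : 37 * (m : ℝ) ^ 2 ≤ 6 * ((C ∩ square n).ncard : ℝ) := by exact_mod_cast h
    have hm' : 2 * (n : ℝ) - 9 ≤ 6 * m := by exact_mod_cast hm
    have hn' : (10000 : ℝ) ≤ n := by exact_mod_cast hn
    rw [ncard_square, le_div_iff₀ (by positivity)]
    push_cast
    nlinarith [mul_self_le_mul_self (by linarith) hm']
  · refine isBoundedUnder_of ⟨1, fun n => div_le_one_of_le₀ ?_ (Nat.cast_nonneg _)⟩
    exact_mod_cast Set.ncard_le_ncard Set.inter_subset_right (square_finite n)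

end TolerantCode

theorem mainTheorem11 :
    (0.17 : ℝ) ≤ TolerantCode.minDensity (Real.sqrt 5) (Real.sqrt 8 - Real.sqrt 5) := by
  refine le_csInf ⟨_, Set.univ, TolerantCode.isIdentifyingCode_univ, rfl⟩ ?_
  rintro _ ⟨C, hC, rfl⟩
  exact hC.le_density
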